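/- All graphs are finite, simple and undirected. For a vertex $v$ of a graph $G$, $N_G(v)$ denotes the subgraph induced on the neighbours of $v$, and $N_G(v,w)$ the subgraph induced on the common neighbours of $v$ and $w$. Let $\mathfrak{I}$ be the smallest isomorphism-closed family of graphs that contains the one-vertex graph $K(1)$ and is closed under: deleting a vertex $v$ with $N_G(v)\in\mathfrak{I}$; gluing a new vertex $v$ so that its neighbourhood is in $\mathfrak{I}$; deleting an edge $\{v_1,v_2\}$ with $N_G(v_1,v_2)\in\mathfrak{I}$; adding an edge between distinct nonadjacent vertices $v_1,v_2$ with $N_G(v_1,v_2)\in\mathfrak{I}$. A vertex $v$ of $G$ is $\mathfrak{I}$-contractible if $N_G(v)\in\mathfrak{I}$, and then $I(G;v)=G-v$. A sequence $S=(v_1,\dots,v_k)$ is a sequence of $\mathfrak{I}$-contractible vertices of $G$ if each $v_i$ is an $\mathfrak{I}$-contractible vertex of $G-\{v_1,\dots,v_{i-1}\}$, and then $I(G;S)=G-\{v_1,\dots,v_k\}$ (the empty sequence is allowed, with $I(G;\emptyset)=G$). Let $A$ be an abelian group. For a graph $G$, let $C_n(G)$ be the group of oriented $n$-chains with coefficients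 in $A$ on the complete subgraphs of $G$ with $n+1$ vertices (oriented by an arbitrary linear order on the vertices, with a subgraph of a graph using the restricted order), with the usual simplicial boundary $\partial$, which is zero on $0$-chains; let $Z_n(G)$ be the cycles, $B_n(G)$ the boundaries and $H_n(G)=Z_n(G)/B_n(G)$. For an $\mathfrak{I}$-contractible vertex $v$ of $G$, an image of a cycle $c\in Z_n(G)$ under $I_\#(v)$ is any chain $a+b$ with $a\in C_n(G-v)$, $b\in C_n(N_G(v))$ and $c=(a+b)-\partial(v*b)$, where $v*[u_0\cdots u_n]=[v\,u_0\cdots u_n]$. For a sequence $S=(v_1,\dots,v_k)$ put $I_\#(S)=I_\#(v_k)\circ\cdots\circ I_\#(v_1)$ (the identity if $k=0$). Let $G_1$ be a graph, $G_0\subset G_1$ a subgraph, and let $S_0$ and $S_1$ be sequences of $\mathfrak{I}$-contractible vertices of $G_0$ and $G_1$, respectively. Then for every $n\ge 0$: (i) for $j=0,1$, every cycle in $Z_n(G_j)$ has an image under $I_\#(S_j)$ that lies in $Z_n(I(G_j;S_j))$, and there is a unique homomorphism $I_*(S_j):H_n(G_j)\to H_n(I(G_j;S_j))$ that sends the class of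 each cycle to the class of each such image of it; this $I_*(S_j)$ is an isomorphism; (ii) there is a homomorphism $\iota_*:H_n(I(G_0;S_0))\to H_n(I(G_1;S_1))$ with $$\iota_*\circ I_*(S_0)=I_*(S_1)\circ i_*,$$ where $i_*:H_n(G_0)\to H_n(G_1)$ is induced by the inclusion; namely $\iota_*=I_*(S_1)\circ i_*\circ I_*(S_0)^{-1}$. -/

import Mathlib

universe u w

namespace GraphHomology

/-- The family of contractible graphs: the smallest family of graphs that contains the one-vertex
graph and is closed under isomorphism and under the four contractible transformations (deleting or
gluing a vertex whose neighbourhood is in the family, deleting or gluing an edge whose common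
neighbourhood is in the family). All its members are finite. -/
inductive IsContractible : {V : Type u} → SimpleGraph V → Prop
  /-- The trivial graph `K(1)`. -/
  | point {V : Type u} (G : SimpleGraph V) (h : Nonempty (Unique V)) : IsContractible G
  /-- Graphs are considered up to isomorphism. -/
  | iso {V W : Type u} (G : SimpleGraph V) (H : SimpleGraph W) (e : Nonempty (G ≃g H))
      (hG : IsContractible G) : IsContractible H
  /-- Deleting a vertex `v` with contractible neighbourhood. -/
  | deleteVertex {V : Type u} (G : SimpleGraph V) (v : V) (hG : IsContractible G)
      (hN : IsContractible (G.induce (G.neighborSet v))) :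
      IsContractible (G.induce {v}ᶜ)
  /-- Gluing a vertex `v` to `G - v` along a contractible neighbourhood. -/
  | glueVertex {V : Type u} (G : SimpleGraph V) (v : V) (hG : IsContractible (G.induce {v}ᶜ))
      (hN : IsContractible (G.induce (G.neighborSet v))) :
      IsContractible G
  /-- Deleting an edge with contractible common neighbourhood. -/
  | deleteEdge {V : Type u} (G : SimpleGraph V) (v₁ v₂ : V) (hG : IsContractible G)
      (hadj : G.Adj v₁ v₂) (hN : IsContractible (G.induce (G.commonNeighbors v₁ v₂))) :
      IsContractible (G.deleteEdges {s(v₁, v₂)})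
  /-- Gluing an edge between distinct nonadjacent vertices with contractible common
  neighbourhood. -/
  | glueEdge {V : Type u} (G : SimpleGraph V) (v₁ v₂ : V) (hG : IsContractible G)
      (hne : v₁ ≠ v₂) (hadj : ¬ G.Adj v₁ v₂)
      (hN : IsContractible (G.induce (G.commonNeighbors v₁ v₂))) :
      IsContractible (G ⊔ SimpleGraph.edge v₁ v₂)

/-- Graphs whose vertices are taken from `V`: a vertex set together with a symmetric irreflexive
adjacency relation on it. The order `≤` is the relation "is a subgraph of". -/
abbrev GraphOn (V : Type u) : Type u := (⊤ : SimpleGraph V).Subgraph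

variable {V : Type u}

/-- The neighbourhood `N_G(v)`, as an induced subgraph of `G`. -/
def nbhd (G : GraphOn V) (v : V) : GraphOn V := G.induce (G.neighborSet v)

/-- `v` is a contractible vertex of `G`. -/
def IsContractibleVertex (G : GraphOn V) (v : V) : Prop :=
  v ∈ G.verts ∧ IsContractible (nbhd G v).coe

/-- `I(G; v) = G - v`. -/
def deleteVertex (G : GraphOn V) (v : V) : GraphOn V := G.deleteVerts {v}

/-- `I(G; S)`: delete the vertices of `S` one after the other. -/
def deleteSeq (G : GraphOn V) : List V → GraphOn V
  | [] => G
  | v :: S => deleteSeq (deleteVertex G v) S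

/-- `S` is a sequence of contractible vertices of `G`: each member is a contractible vertex of the
graph that is left after the deletion of the earlier ones. -/
def IsContractibleSeq (G : GraphOn V) : List V → Prop
  | [] => True
  | v :: S => IsContractibleVertex G v ∧ IsContractibleSeq (deleteVertex G v) S

/-- `s` spans a complete subgraph of `G` on `n + 1` vertices. -/
def IsSimplex (G : GraphOn V) (n : ℕ) (s : Finset V) : Prop :=
  s.card = n + 1 ∧ (∀ v ∈ s, v ∈ G.verts) ∧ (s : Set V).Pairwise G.Adj

theorem IsSimplex.mono {G H : GraphOn V} (h : G ≤ H) {n : ℕ} {s : Finset V}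
    (hs : IsSimplex G n s) : IsSimplex H n s :=
  ⟨hs.1, fun v hv => h.1 (hs.2.1 v hv), fun _ hx _ hy hxy => h.2 (hs.2.2 hx hy hxy)⟩

variable (A : Type w) [AddCommGroup A]

/-- The group `C_n(G; A)` of `n`-chains of `G`, inside the group of all finite formal `A`-linear
combinations of finite sets of vertices. A set `s` stands for the simplex on the elements of `s`
in increasing order, see `boundary`. -/
def chains (G : GraphOn V) (n : ℕ) : AddSubgroup (Finset V →₀ A) where
  carrier := {c | ∀ s ∈ c.support, IsSimplex G n s}
  zero_mem' := by simp
  add_mem' := by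
    classical
    intro a b ha hb s hs
    rcases Finset.mem_union.1 (Finsupp.support_add hs) with h | h
    exacts [ha s h, hb s h]
  neg_mem' := by
    intro a ha s hs
    exact ha s (by simpa using hs)

theorem chains_mono {G H : GraphOn V} (h : G ≤ H) (n : ℕ) : chains A G n ≤ chains A H n :=
  fun _ hc s hs => (hc s hs).mono h

variable [LinearOrder V]

/-- The boundary operator. On the simplex `s = [v₀ < v₁ < ⋯ < v_n]` with `n ≥ 1` it is
`∑ k, (-1)^k [v₀ ⋯ v̂_k ⋯ v_n]` (the position `k` of a vertex is the number of smaller vertices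
of `s`), and it is zero on vertices. -/
noncomputable def boundary : (Finset V →₀ A) →+ (Finset V →₀ A) :=
  Finsupp.liftAddHom fun s =>
    if 2 ≤ s.card then
      ∑ v ∈ s, (-1 : ℤ) ^ (s.filter (· < v)).card • Finsupp.singleAddHom (s.erase v)
    else 0

/-- The join `b ↦ v * b`, with `v * [v₀ ⋯ v_n] = [v v₀ ⋯ v_n]` for `v` not among the `v_i`. The
sign is the one of the permutation that sorts `v, v₀, …, v_n`. -/
noncomputable def join (v : V) : (Finset V →₀ A) →+ (Finset V →₀ A) :=
  Finsupp.liftAddHom fun s =>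
    if v ∈ s then 0
    else (-1 : ℤ) ^ (s.filter (· < v)).card • Finsupp.singleAddHom (insert v s)

/-- The group `Z_n(G; A)` of `n`-cycles. -/
noncomputable def cycles (G : GraphOn V) (n : ℕ) : AddSubgroup (Finset V →₀ A) :=
  chains A G n ⊓ (boundary A).ker

/-- The group `B_n(G; A)` of `n`-boundaries. -/
noncomputable def boundaries (G : GraphOn V) (n : ℕ) : AddSubgroup (Finset V →₀ A) :=
  (chains A G (n + 1)).map (boundary A)

theorem cycles_mono {G H : GraphOn V} (h : G ≤ H) (n : ℕ) : cycles A G n ≤ cycles A H n :=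
  inf_le_inf_right _ (chains_mono A h n)

theorem boundaries_mono {G H : GraphOn V} (h : G ≤ H) (n : ℕ) :
    boundaries A G n ≤ boundaries A H n :=
  AddSubgroup.map_mono (chains_mono A h (n + 1))

/-- The homology group `H_n(G; A) = Z_n(G; A) / B_n(G; A)`. -/
abbrev Homology (G : GraphOn V) (n : ℕ) : Type (max u w) :=
  cycles A G n ⧸ (boundaries A G n).addSubgroupOf (cycles A G n)

/-- The homology class of a cycle. -/
noncomputable def homologyClass (G : GraphOn V) (n : ℕ) : cycles A G n →+ Homology A G n :=
  QuotientAddGroup.mk' _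

/-- The homomorphism `i_* : H_n(G; A) → H_n(H; A)` induced by the inclusion of a subgraph. -/
noncomputable def inclusionMap {G H : GraphOn V} (h : G ≤ H) (n : ℕ) :
    Homology A G n →+ Homology A H n :=
  QuotientAddGroup.map _ _ (AddSubgroup.inclusion (cycles_mono A h n))
    (fun _ hx => boundaries_mono A h n hx)

/-- `z` is an image of the `n`-chain `c` of `G` under `I_#(v)`: for some `a ∈ C_n(G - v)` and
`b ∈ C_n(N_G(v))`, `c = (a + b) - ∂ (v * b)` and `z = a + b`. The chain `b` is not determined by
`c`, so this is a relation. -/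
def IsDeletionImage (G : GraphOn V) (n : ℕ) (v : V) (c z : Finset V →₀ A) : Prop :=
  ∃ a ∈ chains A (deleteVertex G v) n, ∃ b ∈ chains A (nbhd G v) n,
    c = (a + b) - boundary A (join A v b) ∧ z = a + b

/-- `z` is an image of `c` under `I_#(S) = I_#(v_k) ∘ ⋯ ∘ I_#(v_1)`. -/
def IsDeletionSeqImage (n : ℕ) (G : GraphOn V) :
    List V → (Finset V →₀ A) → (Finset V →₀ A) → Prop
  | [], c, z => z = c
  | v :: S, c, z => ∃ d, IsDeletionImage A G n v c d ∧
      IsDeletionSeqImage n (deleteVertex G v) S d z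

/-- `f : H_n(G; A) → H_n(I(G; S); A)` is the homomorphism induced by `I_#(S)`: every cycle `c` of
`G` has an image under `I_#(S)` that is a cycle of `I(G; S)`, and `f` sends the class of `c` to the
class of `z` for each such image `z` of `c`. -/
def IsInducedByDeletion (G : GraphOn V) (S : List V) (n : ℕ)
    (f : Homology A G n →+ Homology A (deleteSeq G S) n) : Prop :=
  (∀ c : cycles A G n, ∃ z : cycles A (deleteSeq G S) n, IsDeletionSeqImage A n G S c z) ∧
    ∀ (c : cycles A G n) (z : cycles A (deleteSeq G S) n), IsDeletionSeqImage A n G S c z →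
      f (homologyClass A G n c) = homologyClass A (deleteSeq G S) n z

end GraphHomology

/-! Deleting an `𝔍`-contractible vertex `v` does not change homology: the inclusion of `G - v` into
`G` induces an isomorphism. An image of `c` under `I_#(v)` differs from `c` by `∂(v * b)`, hence is
homologous to `c` in `G`. So `I_*(S)` can only be the inverse of the inclusion-induced isomorphism,
and the statement about `ι` is then formal.

The isomorphism rests on acyclicity of the augmented complex of `N_G(v)`. Modulo the chains avoiding
`v`, the complex of `G` is that of the link of `v`, shifted by one. Likewise, modulo the chains not
containing both ends of an edge, it is that of the common neighbourhood, shifted by two. If the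
shifted complex is acyclic, any chain with boundary in the subcomplex can be moved into it by
subtracting a boundary (`IsRelativeCopy.exists_sub_mem`). Applied to each of the four
transformations, this shows by induction that members of `𝔍` are acyclic
(`IsContractible.acyclicCliques`); applied once more to `v` in `G`, it gives surjectivity and
injectivity on homology.

The empty simplex is kept in these complexes because it is the link counterpart of the simplex
`{v}`. Chains are ungraded there, and `cardPart` recovers degrees at the end. -/

namespace GraphHomology

/-! ### Ungraded chains and their homogeneous parts -/

section Chains

variable {V : Type u} (A : Type w) [AddCommGroup A]

/-- The chains supported on a set `K` of simplices; the empty simplex is allowed. -/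
def chainsOn (K : Set (Finset V)) : AddSubgroup (Finset V →₀ A) where
  carrier := {c | ∀ s ∈ c.support, s ∈ K}
  zero_mem' := by simp
  add_mem' := by
    classical
    intro a b ha hb s hs
    rcases Finset.mem_union.1 (Finsupp.support_add hs) with h | h
    exacts [ha s h, hb s h]
  neg_mem' := by
    intro a ha s hs
    exact ha s (by simpa using hs)

variable {A}

theorem single_mem_chainsOn {K : Set (Finset V)} {s : Finset V} (a : A) (hs : s ∈ K) :
    Finsupp.single s a ∈ chainsOn A K := by
  classical
  intro t ht
  rw [Finset.mem_singleton.1 (Finsupp.support_single_subset ht)]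
  exact hs

theorem chainsOn_mono {K L : Set (Finset V)} (h : K ⊆ L) : chainsOn A K ≤ chainsOn A L :=
  fun _ hc s hs => h (hc s hs)

theorem map_mem_of_single {M : Type*} [AddCommGroup M] {K : Set (Finset V)} {P : AddSubgroup M}
    (f : (Finset V →₀ A) →+ M) {c : Finset V →₀ A} (hc : c ∈ chainsOn A K)
    (h : ∀ s ∈ K, ∀ a, f (Finsupp.single s a) ∈ P) : f c ∈ P := by
  rw [← Finsupp.sum_single c, Finsupp.sum, map_sum]
  exact sum_mem fun s hs => h s (hc s hs) _

theorem map_eq_of_single {M : Type*} [AddCommGroup M] {K : Set (Finset V)}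
    (f g : (Finset V →₀ A) →+ M) {c : Finset V →₀ A} (hc : c ∈ chainsOn A K)
    (h : ∀ s ∈ K, ∀ a, f (Finsupp.single s a) = g (Finsupp.single s a)) : f c = g c := by
  have := map_mem_of_single (P := ⊥) (f - g) hc (fun s hs a => by simp [h s hs a])
  simpa [sub_eq_zero] using this

variable (A) in
/-- The part of a chain that is supported on the sets with `k` elements. -/
noncomputable def cardPart (k : ℕ) : (Finset V →₀ A) →+ (Finset V →₀ A) :=
  Finsupp.filterAddHom fun s => s.card = k

theorem cardPart_single (k : ℕ) (s : Finset V) (a : A) :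
    cardPart A k (Finsupp.single s a) = if s.card = k then Finsupp.single s a else 0 := by
  split_ifs with h
  · exact Finsupp.filter_single_of_pos _ h
  · exact Finsupp.filter_single_of_neg _ h

theorem cardPart_mem {K : Set (Finset V)} {c : Finset V →₀ A} (hc : c ∈ chainsOn A K) (k : ℕ) :
    cardPart A k c ∈ chainsOn A {s ∈ K | s.card = k} := by
  refine map_mem_of_single _ hc (fun s hs a => ?_)
  rw [cardPart_single]
  split_ifs with h
  exacts [single_mem_chainsOn a ⟨hs, h⟩, zero_mem _]

theorem cardPart_eq {K : Set (Finset V)} {k : ℕ} (hK : ∀ s ∈ K, s.card = k)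
    {c : Finset V →₀ A} (hc : c ∈ chainsOn A K) : cardPart A k c = c :=
  map_eq_of_single (cardPart A k) (AddMonoidHom.id _)
    hc (fun s hs a => by simp [cardPart_single, hK s hs])

end Chains

/-! ### The augmented boundary, joins and faces -/

section Boundary

variable {V : Type u} [LinearOrder V] (A : Type w) [AddCommGroup A]

/-- The sign `(-1)^k`, where `k` is the number of elements of `s` below `v`. -/
def positionSign (v : V) (s : Finset V) : ℤ := (-1) ^ (s.filter (· < v)).card

theorem positionSign_mul_self (v : V) (s : Finset V) :
    positionSign v s * positionSign v s = 1 := by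
  rw [positionSign, ← pow_add, ← two_mul, pow_mul]; simp

theorem positionSign_insert {u v : V} {s : Finset V} (hu : u ∉ s) :
    positionSign v (insert u s) = if u < v then -positionSign v s else positionSign v s := by
  unfold positionSign
  rw [Finset.filter_insert]
  split_ifs with h
  · rw [Finset.card_insert_of_notMem (by simp [hu]), pow_succ]; ring
  · rfl

theorem positionSign_insert_self (v : V) (s : Finset V) :
    positionSign v (insert v s) = positionSign v s := by
  simp [positionSign, Finset.filter_insert]

theorem positionSign_erase_self (v : V) (s : Finset V) :
    positionSign v (s.erase v) = positionSign v s := by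
  by_cases h : v ∈ s
  · rw [← positionSign_insert_self, Finset.insert_erase h]
  · rw [Finset.erase_eq_of_notMem h]

/-- The boundary operator of the augmented chain complex. -/
noncomputable def augBoundary : (Finset V →₀ A) →+ (Finset V →₀ A) :=
  Finsupp.liftAddHom fun s => ∑ v ∈ s, positionSign v s • Finsupp.singleAddHom (s.erase v)

/-- The operator that removes `v` from the simplices that contain it and kills the others. -/
noncomputable def face (v : V) : (Finset V →₀ A) →+ (Finset V →₀ A) :=
  Finsupp.liftAddHom fun s =>
    if v ∈ s then positionSign v s • Finsupp.singleAddHom (s.erase v) else 0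

variable {A}

theorem augBoundary_single (s : Finset V) (a : A) :
    augBoundary A (Finsupp.single s a) =
      ∑ v ∈ s, positionSign v s • Finsupp.single (s.erase v) a := by
  simp [augBoundary]

theorem boundary_single (s : Finset V) (a : A) :
    boundary A (Finsupp.single s a) =
      if 2 ≤ s.card then augBoundary A (Finsupp.single s a) else 0 := by
  rw [augBoundary_single]
  split_ifs with h <;> simp [boundary, h, positionSign]

theorem join_single (v : V) (s : Finset V) (a : A) :
    join A v (Finsupp.single s a) =
      if v ∈ s then 0 else positionSign v s • Finsupp.single (insert v s) a := by
  split_ifs with h <;> simp [join, h, positionSign]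

theorem face_single (v : V) (s : Finset V) (a : A) :
    face A v (Finsupp.single s a) =
      if v ∈ s then positionSign v s • Finsupp.single (s.erase v) a else 0 := by
  split_ifs with h <;> simp [face, h]

theorem face_join_single {v : V} {s : Finset V} (h : v ∉ s) (a : A) :
    face A v (join A v (Finsupp.single s a)) = Finsupp.single s a := by
  rw [join_single, if_neg h, map_zsmul, face_single, if_pos (Finset.mem_insert_self _ _),
    Finset.erase_insert h, smul_smul, positionSign_insert_self, positionSign_mul_self, one_smul]

theorem join_face_single (v : V) (s : Finset V) (a : A) :
    join A v (face A v (Finsupp.single s a)) = if v ∈ s then Finsupp.single s a else 0 := by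
  rw [face_single]
  split_ifs with h
  · rw [map_zsmul, join_single, if_neg (Finset.notMem_erase _ _), Finset.insert_erase h,
      smul_smul, positionSign_erase_self, positionSign_mul_self, one_smul]
  · simp

/-- Whichever of `v`, `w` is smaller counts in the position of the other, so exactly one of the two
factors changes sign. -/
theorem positionSign_mul_insert {v w : V} {s : Finset V} (hv : v ∉ s) (hw : w ∈ s) :
    positionSign v s * positionSign w (insert v s) =
      -(positionSign w s * positionSign v (s.erase w)) := by
  have h : positionSign v s = _ := (congrArg _ (Finset.insert_erase hw)).symm.trans
    (positionSign_insert (Finset.notMem_erase w s))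
  have hne : v ≠ w := fun h => hv (h ▸ hw)
  rw [positionSign_insert hv, h]
  rcases lt_or_gt_of_ne hne with hlt | hlt
  · rw [if_pos hlt, if_neg hlt.not_gt]; ring
  · rw [if_pos hlt, if_neg hlt.not_gt]; ring

/-- The operator `join v` is a contraction of the full simplex. -/
theorem augBoundary_join (v : V) (c : Finset V →₀ A) :
    augBoundary A (join A v c) = c - join A v (augBoundary A c) := by
  refine map_eq_of_single (K := Set.univ) ((augBoundary A).comp (join A v))
    (AddMonoidHom.id _ - (join A v).comp (augBoundary A)) (fun _ _ => trivial) (fun s _ a => ?_)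
  simp only [AddMonoidHom.comp_apply, AddMonoidHom.sub_apply, AddMonoidHom.id_apply]
  rw [augBoundary_single, map_sum]
  simp only [map_zsmul]
  by_cases h : v ∈ s
  · rw [join_single, if_pos h, map_zero, Finset.sum_eq_single v]
    · rw [join_single, if_neg (Finset.notMem_erase _ _), Finset.insert_erase h, smul_smul,
        positionSign_erase_self, positionSign_mul_self, one_smul, sub_self]
    · intro w _ hw
      rw [join_single, if_pos (Finset.mem_erase.2 ⟨hw.symm, h⟩), smul_zero]
    · exact fun h' => absurd h h'
  · rw [join_single, if_neg h, map_zsmul, augBoundary_single, Finset.sum_insert h,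
      Finset.erase_insert h, smul_add, smul_smul, positionSign_insert_self,
      positionSign_mul_self, one_smul, sub_eq_add_neg, Finset.smul_sum, ← Finset.sum_neg_distrib]
    congr 1
    refine Finset.sum_congr rfl fun w hw => ?_
    have hne : v ≠ w := fun h' => h (h' ▸ hw)
    rw [join_single, if_neg fun h' => h (Finset.mem_of_mem_erase h'), smul_smul, smul_smul,
      positionSign_mul_insert h hw, neg_smul, Finset.erase_insert_of_ne hne]

/-- Every nonempty simplex is, up to sign, a join `v * s`, and the contraction formula used twice
gives `∂∂(v * s) = ∂s - ∂(v * ∂s) = v * ∂∂s`, which vanishes by induction. -/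
theorem augBoundary_augBoundary (c : Finset V →₀ A) : augBoundary A (augBoundary A c) = 0 := by
  refine map_eq_of_single (K := Set.univ) ((augBoundary A).comp (augBoundary A)) 0
    (fun _ _ => trivial) (fun s _ a => ?_)
  simp only [AddMonoidHom.comp_apply, AddMonoidHom.zero_apply]
  induction s using Finset.induction_on with
  | empty => simp [augBoundary_single]
  | insert v s hv ih =>
    have h : Finsupp.single (insert v s) a =
        positionSign v s • join A v (Finsupp.single s a) := by
      rw [join_single, if_neg hv, smul_smul, positionSign_mul_self, one_smul]
    rw [h, map_zsmul, map_zsmul, augBoundary_join, map_sub, augBoundary_join, ih trivial]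
    simp

theorem cardPart_augBoundary (k : ℕ) (c : Finset V →₀ A) :
    cardPart A k (augBoundary A c) = augBoundary A (cardPart A (k + 1) c) := by
  refine map_eq_of_single (K := Set.univ) ((cardPart A k).comp (augBoundary A))
    ((augBoundary A).comp (cardPart A (k + 1))) (fun _ _ => trivial) (fun s _ a => ?_)
  simp only [AddMonoidHom.comp_apply]
  rw [augBoundary_single, map_sum, cardPart_single]
  split_ifs with h
  · rw [augBoundary_single]
    refine Finset.sum_congr rfl fun v hv => ?_
    rw [map_zsmul, cardPart_single, if_pos (by rw [Finset.card_erase_of_mem hv, h]; rfl)]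
  · rw [map_zero]
    refine Finset.sum_eq_zero fun v hv => ?_
    rw [map_zsmul, cardPart_single, if_neg, smul_zero]
    rw [Finset.card_erase_of_mem hv]
    have := Finset.card_pos.2 ⟨v, hv⟩
    omega

theorem cardPart_join (k : ℕ) (v : V) (c : Finset V →₀ A) :
    cardPart A (k + 1) (join A v c) = join A v (cardPart A k c) := by
  refine map_eq_of_single (K := Set.univ) ((cardPart A (k + 1)).comp (join A v))
    ((join A v).comp (cardPart A k)) (fun _ _ => trivial) (fun s _ a => ?_)
  simp only [AddMonoidHom.comp_apply]
  rw [join_single, cardPart_single]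
  by_cases h : v ∈ s
  · rw [if_pos h, map_zero]
    split_ifs <;> simp [join_single, h]
  · rw [if_neg h, map_zsmul, cardPart_single, Finset.card_insert_of_notMem h]
    by_cases hk : s.card = k <;> simp [hk, join_single, h]

theorem augBoundary_mem {K : Set (Finset V)} {c : Finset V →₀ A} (hc : c ∈ chainsOn A K)
    (hK : IsLowerSet K) : augBoundary A c ∈ chainsOn A K := by
  refine map_mem_of_single _ hc (fun s hs a => ?_)
  rw [augBoundary_single]
  exact sum_mem fun v _ => zsmul_mem
    (single_mem_chainsOn a (hK (Finset.erase_subset _ _) hs)) _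

theorem join_mem {K L : Set (Finset V)} {v : V} {c : Finset V →₀ A} (hc : c ∈ chainsOn A L)
    (h : ∀ s ∈ L, v ∉ s → insert v s ∈ K) : join A v c ∈ chainsOn A K := by
  refine map_mem_of_single _ hc (fun s hs a => ?_)
  rw [join_single]
  split_ifs with hv
  exacts [zero_mem _, zsmul_mem (single_mem_chainsOn a (h s hs hv)) _]

theorem face_mem {K L : Set (Finset V)} {v : V} {c : Finset V →₀ A} (hc : c ∈ chainsOn A K)
    (h : ∀ s ∈ K, v ∈ s → s.erase v ∈ L) : face A v c ∈ chainsOn A L := by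
  refine map_mem_of_single _ hc (fun s hs a => ?_)
  rw [face_single]
  split_ifs with hv
  exacts [zsmul_mem (single_mem_chainsOn a (h s hs hv)) _, zero_mem _]

end Boundary
-- Acyclicity relative to an acyclic link
section Acyclic

/-- A subgroup of a group with a differential `d` is acyclic if all its cycles are boundaries. -/
def IsAcyclic {M : Type*} [AddCommGroup M] (d : M →+ M) (K : AddSubgroup M) : Prop :=
  ∀ c ∈ K, d c = 0 → ∃ e ∈ K, d e = c

/-- A splitting of `K` into `K₀` and a copy of `L`, shifted by `T`; up to elements of `K₀` and the
sign `ε`, the differential commutes with `T`. -/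
structure IsRelativeCopy {M : Type*} [AddCommGroup M] (d S T : M →+ M) (ε : ℤˣ)
    (K K₀ L : AddSubgroup M) : Prop where
  le : K₀ ≤ K
  map_T : ∀ b ∈ L, T b ∈ K
  map_S : ∀ c ∈ K, S c ∈ L
  sub_mem : ∀ c ∈ K, c - T (S c) ∈ K₀
  S_eq_zero : ∀ c ∈ K₀, S c = 0
  S_T : ∀ b ∈ L, S (T b) = b
  d_T : ∀ b ∈ L, d (T b) - (ε : ℤ) • T (d b) ∈ K₀
  d_mem : ∀ c ∈ K₀, d c ∈ K₀
  d_mem_L : ∀ b ∈ L, d b ∈ L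

namespace IsRelativeCopy

variable {M : Type*} [AddCommGroup M] {d S T : M →+ M} {ε : ℤˣ} {K K₀ L : AddSubgroup M}

/-- Modulo `K₀`, `c` equals `T (S c)`. As `d c` vanishes modulo `K₀`, `S c` is a cycle of `L`, hence
some `d e`; then `T (d e)` agrees with `ε • d (T e)` modulo `K₀`. Only `d c ∈ K₀` is needed, not `d
c = 0`, so the lemma serves both to move cycles and to move the chains that they bound. -/
theorem exists_sub_mem (h : IsRelativeCopy d S T ε K K₀ L) (hL : IsAcyclic d L) {c : M}
    (hc : c ∈ K) (hdc : d c ∈ K₀) : ∃ e ∈ L, c - d (T ((ε : ℤ) • e)) ∈ K₀ := by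
  have hε : ∀ x : M, (ε : ℤ) • (ε : ℤ) • x = x := fun x => by
    rw [smul_smul, ← Units.val_mul, Int.units_mul_self, Units.val_one, one_smul]
  have hb := h.map_S c hc
  have ha := h.sub_mem c hc
  have h1 : d (T (S c)) ∈ K₀ := by
    have := _root_.sub_mem hdc (h.d_mem _ ha)
    rwa [map_sub, sub_sub_cancel] at this
  have h2 : T (d (S c)) ∈ K₀ := by
    have := zsmul_mem (_root_.sub_mem h1 (h.d_T _ hb)) (ε : ℤ)
    rwa [sub_sub_cancel, hε] at this
  have h3 : d (S c) = 0 := by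
    rw [← h.S_T _ (h.d_mem_L _ hb), h.S_eq_zero _ h2]
  obtain ⟨e, he, hde⟩ := hL _ hb h3
  refine ⟨e, he, ?_⟩
  have := _root_.sub_mem ha (zsmul_mem (h.d_T e he) (ε : ℤ))
  rwa [hde, smul_sub, hε, sub_sub, add_sub_cancel, ← map_zsmul, ← map_zsmul] at this

theorem isAcyclic_iff (h : IsRelativeCopy d S T ε K K₀ L) (hd : ∀ x, d (d x) = 0)
    (hL : IsAcyclic d L) : IsAcyclic d K ↔ IsAcyclic d K₀ := by
  constructor
  · intro hK a ha hda
    obtain ⟨c, hc, rfl⟩ := hK a (h.le ha) hda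
    obtain ⟨e, -, he⟩ := h.exists_sub_mem hL hc ha
    exact ⟨_, he, by rw [map_sub, hd, sub_zero]⟩
  · intro hK₀ c hc hdc
    obtain ⟨e, he, h'⟩ := h.exists_sub_mem hL hc (hdc ▸ zero_mem _)
    obtain ⟨p, hp, hdp⟩ := hK₀ _ h' (by rw [map_sub, hd, hdc, sub_zero])
    exact ⟨p + T ((ε : ℤ) • e), add_mem (h.le hp) (h.map_T _ (zsmul_mem he _)),
      by rw [map_add, hdp, sub_add_cancel]⟩

end IsRelativeCopy

variable {V : Type u} [LinearOrder V] (A : Type w) [AddCommGroup A]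

/-- The third group is the chains on the link of `v`. Since `∂(v * b) = b - v * ∂b`, the error in
commuting `∂` with the join is `b` itself, which avoids `v`; this forces `ε = -1`. -/
theorem isRelativeCopy_vertex {K : Set (Finset V)} (hK : IsLowerSet K) (v : V) :
    IsRelativeCopy (augBoundary A) (face A v) (join A v) (-1) (chainsOn A K)
      (chainsOn A {s ∈ K | v ∉ s}) (chainsOn A {s | v ∉ s ∧ insert v s ∈ K}) where
  le := chainsOn_mono fun _ h => h.1
  map_T b hb := join_mem hb (fun s hs _ => hs.2)
  map_S c hc := face_mem hc (fun s hs hv =>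
    ⟨Finset.notMem_erase _ _, by rwa [Finset.insert_erase hv]⟩)
  sub_mem c hc := by
    refine map_mem_of_single (AddMonoidHom.id _ - (join A v).comp (face A v))
      hc (fun s hs a => ?_)
    simp only [AddMonoidHom.sub_apply, AddMonoidHom.id_apply, AddMonoidHom.comp_apply,
      join_face_single]
    split_ifs with h
    · simp
    · rw [sub_zero]; exact single_mem_chainsOn a ⟨hs, h⟩
  S_eq_zero c hc := map_eq_of_single (face A v) 0
    hc (fun s hs a => by rw [face_single, if_neg hs.2]; rfl)
  S_T b hb := map_eq_of_single ((face A v).comp (join A v)) (AddMonoidHom.id _)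
    hb (fun s hs a => face_join_single hs.1 a)
  d_T b hb := by
    rw [augBoundary_join]
    have : b - join A v (augBoundary A b) - ((-1 : ℤˣ) : ℤ) • join A v (augBoundary A b) = b := by
      simp
    rw [this]
    exact fun s hs => ⟨hK (Finset.subset_insert v s) (hb s hs).2, (hb s hs).1⟩
  d_mem c hc := augBoundary_mem
    hc (fun s t hts hs => ⟨hK hts hs.1, fun h => hs.2 (hts h)⟩)
  d_mem_L b hb := augBoundary_mem
    hb (fun s t hts hs => ⟨fun h => hs.1 (hts h), hK (Finset.insert_subset_insert v hts) hs.2⟩)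

/-- Two joins cancel the sign, so `ε = 1`. The error `w * b - v * b` has simplices containing only
one of `v`, `w`. -/
theorem isRelativeCopy_edge {K : Set (Finset V)} (hK : IsLowerSet K) {v w : V} (hvw : v ≠ w) :
    IsRelativeCopy (augBoundary A) ((face A w).comp (face A v)) ((join A v).comp (join A w)) 1
      (chainsOn A K) (chainsOn A {s ∈ K | ¬ (v ∈ s ∧ w ∈ s)})
      (chainsOn A {s | v ∉ s ∧ w ∉ s ∧ insert v (insert w s) ∈ K}) where
  le := chainsOn_mono fun _ h => h.1
  map_T b hb := by
    refine join_mem (L := {s | insert v s ∈ K}) ?_ (fun s hs _ => hs)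
    exact join_mem hb (fun s hs _ => hs.2.2)
  map_S c hc := by
    refine face_mem (K := {s | v ∉ s ∧ insert v s ∈ K}) ?_ (fun s hs hw => ?_)
    · exact face_mem hc (fun s hs hv =>
        ⟨Finset.notMem_erase _ _, by rwa [Finset.insert_erase hv]⟩)
    · refine ⟨fun h => hs.1 (Finset.mem_of_mem_erase h), Finset.notMem_erase _ _, ?_⟩
      rw [Finset.insert_erase hw]
      exact hs.2
  sub_mem c hc := by
    refine map_mem_of_single (AddMonoidHom.id _ - ((join A v).comp (join A w)).comp
      ((face A w).comp (face A v))) hc (fun s hs a => ?_)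
    simp only [AddMonoidHom.sub_apply, AddMonoidHom.id_apply, AddMonoidHom.comp_apply]
    by_cases hv : v ∈ s
    · have h1 : join A v (face A v (Finsupp.single s a)) = Finsupp.single s a := by
        rw [join_face_single, if_pos hv]
      rw [face_single, if_pos hv, map_zsmul, map_zsmul, join_face_single]
      by_cases hw : w ∈ s
      -- The signed simplex is refolded into `face A v` of `s`, so that `h1` applies.
      · rw [if_pos (Finset.mem_erase.2 ⟨hvw.symm, hw⟩), ← if_pos (c := v ∈ s)
          (t := positionSign v s • Finsupp.single (s.erase v) a) (e := 0) hv, ← face_single, h1,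
          sub_self]
        exact zero_mem _
      · rw [if_neg fun h => hw (Finset.mem_of_mem_erase h), smul_zero, map_zero, sub_zero]
        exact single_mem_chainsOn a ⟨hs, fun h => hw h.2⟩
    · rw [face_single, if_neg hv]
      simp only [map_zero, sub_zero]
      exact single_mem_chainsOn a ⟨hs, fun h => hv h.1⟩
  S_eq_zero c hc := by
    refine map_eq_of_single ((face A w).comp (face A v)) 0 hc (fun s hs a => ?_)
    simp only [AddMonoidHom.comp_apply, AddMonoidHom.zero_apply]
    rw [face_single]
    split_ifs with hv
    · rw [map_zsmul, face_single,
        if_neg fun h => hs.2 ⟨hv, Finset.mem_of_mem_erase h⟩, smul_zero]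
    · exact map_zero _
  S_T b hb := by
    refine map_eq_of_single (((face A w).comp (face A v)).comp ((join A v).comp (join A w)))
      (AddMonoidHom.id _) hb (fun s hs a => ?_)
    simp only [AddMonoidHom.comp_apply, AddMonoidHom.id_apply]
    rw [join_single w, if_neg hs.2.1, map_zsmul, map_zsmul, face_join_single
      (by simp [hvw, hs.1]), ← if_neg (c := w ∈ s) (t := 0)
      (e := positionSign w s • Finsupp.single (insert w s) a) hs.2.1, ← join_single,
      face_join_single hs.2.1]
  d_T b hb := by
    simp only [AddMonoidHom.comp_apply]
    rw [augBoundary_join, augBoundary_join, map_sub]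
    have : join A w b - (join A v b - join A v (join A w (augBoundary A b))) -
        ((1 : ℤˣ) : ℤ) • join A v (join A w (augBoundary A b)) =
        join A w b - join A v b := by
      rw [Units.val_one, one_smul]; abel
    rw [this]
    refine sub_mem (join_mem hb (fun s hs _ => ⟨hK (Finset.subset_insert v _) hs.2.2, ?_⟩))
      (join_mem hb (fun s hs _ => ⟨hK ?_ hs.2.2, ?_⟩))
    · simp [hvw, hs.1]
    · exact Finset.insert_subset_insert v (Finset.subset_insert w s)
    · simp [hvw.symm, hs.2.1]
  d_mem c hc := augBoundary_mem
    hc (fun s t hts hs => ⟨hK hts hs.1, fun h => hs.2 ⟨hts h.1, hts h.2⟩⟩)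
  d_mem_L b hb := augBoundary_mem hb (fun s t hts hs =>
    ⟨fun h => hs.1 (hts h), fun h => hs.2.1 (hts h),
      hK (Finset.insert_subset_insert v (Finset.insert_subset_insert w hts)) hs.2.2⟩)

theorem isAcyclic_of_cone {K : Set (Finset V)} (v : V) (h : ∀ s ∈ K, insert v s ∈ K) :
    IsAcyclic (augBoundary A) (chainsOn A K) := fun c hc hdc =>
  ⟨join A v c, join_mem hc (fun s hs _ => h s hs), by
    rw [augBoundary_join, hdc, map_zero, sub_zero]⟩

end Acyclic

/-! ### Transport along order embeddings -/

section Transport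

variable {V : Type*} {W : Type*} [LinearOrder V] [LinearOrder W] (A : Type w) [AddCommGroup A]

/-- An order embedding preserves the position of a vertex in a simplex, hence all signs. -/
theorem mapDomain_augBoundary (f : V ↪o W) (c : Finset V →₀ A) :
    augBoundary A (c.mapDomain (Finset.map f.toEmbedding)) =
      (augBoundary A c).mapDomain (Finset.map f.toEmbedding) := by
  refine map_eq_of_single (K := Set.univ)
    ((augBoundary A).comp (Finsupp.mapDomain.addMonoidHom (Finset.map f.toEmbedding)))
    ((Finsupp.mapDomain.addMonoidHom (Finset.map f.toEmbedding)).comp (augBoundary A))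
    (fun _ _ => trivial) (fun s _ a => ?_)
  simp only [AddMonoidHom.comp_apply, Finsupp.mapDomain.addMonoidHom_apply,
    Finsupp.mapDomain_single]
  rw [augBoundary_single, augBoundary_single, ← Finsupp.mapDomain.addMonoidHom_apply, map_sum,
    Finset.sum_map]
  refine Finset.sum_congr rfl fun v _ => ?_
  rw [map_zsmul, Finsupp.mapDomain.addMonoidHom_apply, Finsupp.mapDomain_single,
    Finset.map_erase]
  congr 1
  simp [positionSign, Finset.filter_map]

theorem isAcyclic_image_iff (f : V ↪o W) (K : Set (Finset V)) :
    IsAcyclic (augBoundary A) (chainsOn A (Finset.map f.toEmbedding '' K)) ↔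
      IsAcyclic (augBoundary A) (chainsOn A K) := by
  have hinj : Function.Injective
      (Finsupp.mapDomain (M := A) (Finset.map f.toEmbedding)) :=
    Finsupp.mapDomain_injective (Finset.map_injective _)
  have hmem : ∀ c ∈ chainsOn A K,
      c.mapDomain (Finset.map f.toEmbedding) ∈ chainsOn A (Finset.map f.toEmbedding '' K) :=
    fun c hc => map_mem_of_single (Finsupp.mapDomain.addMonoidHom (Finset.map f.toEmbedding))
      hc (fun s hs a => by
        rw [Finsupp.mapDomain.addMonoidHom_apply, Finsupp.mapDomain_single]
        exact single_mem_chainsOn a ⟨s, hs, rfl⟩)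
  have hsurj : ∀ c ∈ chainsOn A (Finset.map f.toEmbedding '' K),
      ∃ e ∈ chainsOn A K, e.mapDomain (Finset.map f.toEmbedding) = c := by
    intro c hc
    refine map_mem_of_single (P := (chainsOn A K).map
      (Finsupp.mapDomain.addMonoidHom (Finset.map f.toEmbedding))) (AddMonoidHom.id _) hc ?_
    rintro _ ⟨s, hs, rfl⟩ a
    exact ⟨Finsupp.single s a, single_mem_chainsOn a hs, Finsupp.mapDomain_single⟩
  constructor
  · intro h c hc hdc
    obtain ⟨e, he, hde⟩ := h _ (hmem c hc) (by rw [mapDomain_augBoundary, hdc,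
      Finsupp.mapDomain_zero])
    obtain ⟨e, he', rfl⟩ := hsurj e he
    exact ⟨e, he', hinj (by rw [← mapDomain_augBoundary, hde])⟩
  · intro h c hc hdc
    obtain ⟨c, hc', rfl⟩ := hsurj c hc
    obtain ⟨e, he, rfl⟩ := h c hc' (hinj (by
      rw [← mapDomain_augBoundary, hdc, Finsupp.mapDomain_zero]))
    exact ⟨_, hmem e he, mapDomain_augBoundary A f e⟩

end Transport
-- Clique complexes and their links
section Cliques

/-- The simplices (the empty one included) of the clique complex of a graph. -/
def cliques {V : Type*} (G : SimpleGraph V) : Set (Finset V) := {s | G.IsClique (s : Set V)}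

theorem isLowerSet_cliques {V : Type*} (G : SimpleGraph V) : IsLowerSet (cliques G) :=
  fun _ _ hts hs => Set.Pairwise.mono (Finset.coe_subset.2 hts) hs

theorem map_image_cliques_induce {V : Type*} (G : SimpleGraph V) (U : Set V) :
    Finset.map (Function.Embedding.subtype (· ∈ U)) '' cliques (G.induce U) =
      {s ∈ cliques G | (s : Set V) ⊆ U} := by
  ext s
  constructor
  · rintro ⟨t, ht, rfl⟩
    refine ⟨?_, ?_⟩
    · intro x hx y hy hxy
      simp only [Finset.coe_map, Set.mem_image, Finset.mem_coe] at hx hy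
      obtain ⟨x, hx, rfl⟩ := hx
      obtain ⟨y, hy, rfl⟩ := hy
      exact ht hx hy fun h => hxy (h ▸ rfl)
    · intro x hx
      simp only [Finset.coe_map, Set.mem_image, Finset.mem_coe] at hx
      obtain ⟨x, hx, rfl⟩ := hx
      exact x.2
  · rintro ⟨hs, hU⟩
    classical
    refine ⟨s.subtype (· ∈ U), ?_, Finset.subtype_map_of_mem fun x hx => hU hx⟩
    intro x hx y hy hxy
    exact hs (by simpa using hx) (by simpa using hy) fun h => hxy (Subtype.ext h)

theorem map_image_cliques_iso {V W : Type*} {G : SimpleGraph V} {H : SimpleGraph W}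
    (e : G ≃g H) : Finset.map e.toEquiv.toEmbedding '' cliques G = cliques H := by
  ext s
  constructor
  · rintro ⟨t, ht, rfl⟩ x hx y hy hxy
    simp only [Finset.coe_map, Set.mem_image, Finset.mem_coe] at hx hy
    obtain ⟨x, hx, rfl⟩ := hx
    obtain ⟨y, hy, rfl⟩ := hy
    exact e.map_adj_iff.2 (ht hx hy fun h => hxy (h ▸ rfl))
  · intro hs
    refine ⟨s.map e.symm.toEquiv.toEmbedding, ?_, ?_⟩
    · intro x hx y hy hxy
      simp only [Finset.coe_map, Set.mem_image, Finset.mem_coe] at hx hy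
      obtain ⟨x, hx, rfl⟩ := hx
      obtain ⟨y, hy, rfl⟩ := hy
      exact e.symm.map_adj_iff.2 (hs hx hy fun h => hxy (h ▸ rfl))
    · rw [Finset.map_map]
      convert Finset.map_refl
      ext x
      exact e.apply_symm_apply x

theorem sep_notMem_cliques {V : Type*} (G : SimpleGraph V) (v : V) :
    {s ∈ cliques G | v ∉ s} = {s ∈ cliques G | (s : Set V) ⊆ {v}ᶜ} := by
  ext s; simp

theorem cliques_deleteEdges {V : Type*} (G : SimpleGraph V) {v w : V} (hvw : v ≠ w) :
    cliques (G.deleteEdges {s(v, w)}) = {s ∈ cliques G | ¬ (v ∈ s ∧ w ∈ s)} := by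
  ext s
  simp only [cliques, Set.mem_ofPred_eq, SimpleGraph.IsClique]
  constructor
  · refine fun h => ⟨fun x hx y hy hxy => (SimpleGraph.deleteEdges_adj.1 (h hx hy hxy)).1, ?_⟩
    rintro ⟨hv, hw⟩
    exact (SimpleGraph.deleteEdges_adj.1 (h hv hw hvw)).2 rfl
  · rintro ⟨h, h'⟩ x hx y hy hxy
    refine SimpleGraph.deleteEdges_adj.2 ⟨h hx hy hxy, fun he => h' ?_⟩
    rcases Sym2.eq_iff.1 (Set.mem_singleton_iff.1 he) with ⟨rfl, rfl⟩ | ⟨rfl, rfl⟩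
    exacts [⟨hx, hy⟩, ⟨hy, hx⟩]

/-- The clique complex is acyclic, whatever order is used to orient the simplices. -/
def AcyclicCliques (A : Type w) [AddCommGroup A] {V : Type u} (G : SimpleGraph V) : Prop :=
  ∀ [LinearOrder V], IsAcyclic (augBoundary A) (chainsOn A (cliques G))

/-- A vertex outside the range of `f`, necessarily `v`, is placed on top. -/
theorem exists_linearOrder_extending {U V : Type*} [LinearOrder U] (f : U ↪ V) (v : V)
    (hf : ∀ w ≠ v, w ∈ Set.range f) :
    ∃ _ : LinearOrder V, ∃ g : U ↪o V, g.toEmbedding = f := by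
  classical
  let g : V → WithTop U := fun w => if h : w ∈ Set.range f then (h.choose : U) else ⊤
  have hg : ∀ x, g (f x) = x := fun x => by
    have h : f x ∈ Set.range f := ⟨x, rfl⟩
    simp only [g, dif_pos h]
    exact congrArg _ (f.injective h.choose_spec)
  have hg' : ∀ w ∉ Set.range f, g w = ⊤ := fun w h => dif_neg h
  have hinj : Function.Injective g := by
    intro x y hxy
    by_cases hx : x ∈ Set.range f <;> by_cases hy : y ∈ Set.range f
    · obtain ⟨x, rfl⟩ := hx
      obtain ⟨y, rfl⟩ := hy
      rw [hg, hg] at hxy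
      rw [WithTop.coe_injective hxy]
    · obtain ⟨x, rfl⟩ := hx
      simp [hg, hg' y hy] at hxy
    · obtain ⟨y, rfl⟩ := hy
      simp [hg, hg' x hx] at hxy
    · rw [not_imp_comm.1 (hf x) hx, not_imp_comm.1 (hf y) hy]
  refine ⟨LinearOrder.lift' g hinj, ⟨f, fun {x y} => ?_⟩, rfl⟩
  change g (f x) ≤ g (f y) ↔ x ≤ y
  rw [hg, hg, WithTop.coe_le_coe]

variable {V : Type u} [LinearOrder V] {A : Type w} [AddCommGroup A]

theorem AcyclicCliques.isAcyclic_induce {G : SimpleGraph V} {U : Set V}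
    (h : AcyclicCliques A (G.induce U)) :
    IsAcyclic (augBoundary A) (chainsOn A {s ∈ cliques G | (s : Set V) ⊆ U}) := by
  rw [← map_image_cliques_induce]
  exact (isAcyclic_image_iff A (OrderEmbedding.subtype (· ∈ U)) _).2 h

theorem link_vertex_cliques (G : SimpleGraph V) (v : V) :
    {s : Finset V | v ∉ s ∧ insert v s ∈ cliques G} =
      {s ∈ cliques G | (s : Set V) ⊆ G.neighborSet v} := by
  ext s
  simp only [cliques, Set.mem_ofPred_eq, Finset.coe_insert, SimpleGraph.isClique_insert]
  constructor
  · rintro ⟨hv, hs, h⟩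
    exact ⟨hs, fun x hx => h x hx fun h' => hv (h' ▸ hx)⟩
  · rintro ⟨hs, h⟩
    exact ⟨fun hv => G.irrefl (h hv), hs, fun x hx _ => h hx⟩

theorem link_edge_cliques (G : SimpleGraph V) {v w : V} (hvw : G.Adj v w) :
    {s : Finset V | v ∉ s ∧ w ∉ s ∧ insert v (insert w s) ∈ cliques G} =
      {s ∈ cliques G | (s : Set V) ⊆ G.commonNeighbors v w} := by
  ext s
  simp only [cliques, Set.mem_ofPred_eq, Finset.coe_insert, SimpleGraph.isClique_insert]
  constructor
  · rintro ⟨hv, hw, ⟨hs, h⟩, h'⟩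
    exact ⟨hs, fun x hx => ⟨h' x (.inr hx) fun e => hv (e ▸ hx), h x hx fun e => hw (e ▸ hx)⟩⟩
  · rintro ⟨hs, h⟩
    refine ⟨fun hv => G.irrefl (h hv).1, fun hw => G.irrefl (h hw).2,
      ⟨hs, fun x hx _ => (h hx).2⟩, ?_⟩
    rintro x (rfl | hx) -
    exacts [hvw, (h hx).1]

theorem isAcyclic_induce_compl_iff {G : SimpleGraph V} {v : V}
    (hN : AcyclicCliques A (G.induce (G.neighborSet v))) :
    IsAcyclic (augBoundary A) (chainsOn A (cliques G)) ↔
      IsAcyclic (augBoundary A) (chainsOn A {s ∈ cliques G | (s : Set V) ⊆ {v}ᶜ}) := by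
  rw [← sep_notMem_cliques]
  refine (isRelativeCopy_vertex A (isLowerSet_cliques G) v).isAcyclic_iff
    augBoundary_augBoundary ?_
  rw [link_vertex_cliques]
  exact hN.isAcyclic_induce

theorem isAcyclic_deleteEdge_iff {G : SimpleGraph V} {v w : V} (hvw : G.Adj v w)
    (hN : AcyclicCliques A (G.induce (G.commonNeighbors v w))) :
    IsAcyclic (augBoundary A) (chainsOn A (cliques G)) ↔
      IsAcyclic (augBoundary A) (chainsOn A (cliques (G.deleteEdges {s(v, w)}))) := by
  rw [cliques_deleteEdges G hvw.ne]
  refine (isRelativeCopy_edge A (isLowerSet_cliques G) hvw.ne).isAcyclic_iff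
    augBoundary_augBoundary ?_
  rw [link_edge_cliques G hvw]
  exact hN.isAcyclic_induce

end Cliques

/-! ### Contractible graphs are acyclic -/

section Contractible

variable {A : Type w} [AddCommGroup A]

theorem IsContractible.acyclicCliques {V : Type u} {G : SimpleGraph V} (hG : IsContractible G) :
    AcyclicCliques A G := by
  induction hG with
  | point G h =>
    intro _
    obtain ⟨_⟩ := h
    exact isAcyclic_of_cone A default fun s _ x _ y _ hxy => absurd (Subsingleton.elim x y) hxy
  | iso G H e _ ih =>
    intro _
    obtain ⟨e⟩ := e
    -- The order is pulled back along `e`, so that `e` preserves it.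
    let _ : LinearOrder _ := LinearOrder.lift' e e.injective
    rw [← map_image_cliques_iso e]
    exact (isAcyclic_image_iff A (⟨e.toEquiv.toEmbedding, Iff.rfl⟩ : _ ↪o _) _).2 ih
  | deleteVertex G v _ _ ihG ihN =>
    intro _
    -- The order given is on `G - v` only; to use the hypothesis on `G` it is extended to `v`.
    obtain ⟨_, f, hf⟩ := exists_linearOrder_extending
      (Function.Embedding.subtype (· ∈ ({v}ᶜ : Set _))) v fun w hw => ⟨⟨w, hw⟩, rfl⟩
    have h := (isAcyclic_induce_compl_iff ihN).1 ihG
    rwa [← map_image_cliques_induce, ← hf, isAcyclic_image_iff] at h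
  | glueVertex G v _ _ ihG ihN =>
    intro _
    exact (isAcyclic_induce_compl_iff ihN).2 ihG.isAcyclic_induce
  | deleteEdge G v w _ hadj _ ihG ihN =>
    intro _
    exact (isAcyclic_deleteEdge_iff hadj ihN).1 ihG
  | glueEdge G v w _ hne hadj _ ihG ihN =>
    intro _
    -- Gluing an edge is edge deletion read backwards, with the same common neighbourhood.
    have hdel : (G ⊔ SimpleGraph.edge v w).deleteEdges {s(v, w)} = G := by
      ext x y
      simp only [SimpleGraph.deleteEdges_adj, SimpleGraph.sup_adj, SimpleGraph.edge_adj,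
        Set.mem_singleton_iff, Sym2.eq_iff]
      constructor
      · tauto
      · refine fun h => ⟨.inl h, ?_⟩
        rintro (⟨rfl, rfl⟩ | ⟨rfl, rfl⟩)
        exacts [hadj h, hadj h.symm]
    have hcn : (G ⊔ SimpleGraph.edge v w).commonNeighbors v w = G.commonNeighbors v w := by
      ext x
      simp only [SimpleGraph.mem_commonNeighbors, SimpleGraph.sup_adj, SimpleGraph.edge_adj]
      refine ⟨?_, fun h => ⟨.inl h.1, .inl h.2⟩⟩
      rintro ⟨h₁, h₂⟩
      have hxv : x ≠ v := by rintro rfl; simp at h₁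
      have hxw : x ≠ w := by rintro rfl; simp at h₂
      exact ⟨h₁.resolve_right (by tauto), h₂.resolve_right (by tauto)⟩
    have hind : (G ⊔ SimpleGraph.edge v w).induce (G.commonNeighbors v w) =
        G.induce (G.commonNeighbors v w) := by
      ext x y
      have hx : x.1 ≠ v := fun h => G.irrefl (h ▸ x.2.1)
      have hx' : x.1 ≠ w := fun h => G.irrefl (h ▸ x.2.2)
      simp [SimpleGraph.edge_adj, hx, hx']
    have hsup : (G ⊔ SimpleGraph.edge v w).Adj v w :=
      .inr ((SimpleGraph.edge_adj ..).2 ⟨.inl ⟨rfl, rfl⟩, hne⟩)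
    refine (isAcyclic_deleteEdge_iff hsup ?_).2 (by rw [hdel]; exact ihG)
    rw [hcn, hind]
    exact ihN

end Contractible
-- Simplices of subgraphs
section Faces

/-- The simplices (the empty one included) of the clique complex of a subgraph. -/
def faces {V : Type u} (G : GraphOn V) : Set (Finset V) :=
  {s | (∀ v ∈ s, v ∈ G.verts) ∧ (s : Set V).Pairwise G.Adj}

theorem isLowerSet_faces {V : Type u} (G : GraphOn V) : IsLowerSet (faces G) :=
  fun _ _ hts hs => ⟨fun v hv => hs.1 v (hts hv), hs.2.mono (Finset.coe_subset.2 hts)⟩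

theorem faces_deleteVertex {V : Type u} (G : GraphOn V) (v : V) :
    faces (deleteVertex G v) = {s ∈ faces G | v ∉ s} := by
  ext s
  constructor
  · rintro ⟨h₁, h₂⟩
    exact ⟨⟨fun x hx => (h₁ x hx).1, fun x hx y hy hxy =>
      (SimpleGraph.Subgraph.deleteVerts_adj.1 (h₂ hx hy hxy)).2.2.2.2⟩, fun hv => (h₁ v hv).2 rfl⟩
  · rintro ⟨⟨h₁, h₂⟩, hv⟩
    have h : ∀ x ∈ s, x ∉ ({v} : Set V) := fun x hx hxv => hv (Set.mem_singleton_iff.1 hxv ▸ hx)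
    exact ⟨fun x hx => ⟨h₁ x hx, h x hx⟩, fun x hx y hy hxy =>
      SimpleGraph.Subgraph.deleteVerts_adj.2
        ⟨h₁ x hx, h x hx, h₁ y hy, h y hy, h₂ hx hy hxy⟩⟩

theorem deleteVertex_le {V : Type u} (G : GraphOn V) (v : V) : deleteVertex G v ≤ G :=
  SimpleGraph.Subgraph.deleteVerts_le

theorem nbhd_le_deleteVertex {V : Type u} (G : GraphOn V) (v : V) : nbhd G v ≤ deleteVertex G v := by
  have hne : ∀ {x}, G.Adj v x → x ∉ ({v} : Set V) := fun h e => (G.adj_sub h).ne e.symm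
  refine ⟨fun x hx => ⟨G.edge_vert (SimpleGraph.Subgraph.Adj.symm hx), hne hx⟩, fun x y h => ?_⟩
  obtain ⟨hx, hy, hxy⟩ := h
  exact SimpleGraph.Subgraph.deleteVerts_adj.2
    ⟨G.edge_vert hxy, hne hx, G.edge_vert hxy.symm, hne hy, hxy⟩

theorem deleteSeq_le {V : Type u} (G : GraphOn V) (S : List V) : deleteSeq G S ≤ G := by
  induction S generalizing G with
  | nil => exact le_rfl
  | cons v S ih => exact (ih _).trans (deleteVertex_le G v)

theorem chains_eq_chainsOn {V : Type u} (A : Type w) [AddCommGroup A] (G : GraphOn V) (n : ℕ) :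
    chains A G n = chainsOn A {s ∈ faces G | s.card = n + 1} := by
  ext c
  exact forall₂_congr fun s _ => and_comm

theorem faces_nbhd {V : Type u} [DecidableEq V] {G : GraphOn V} {v : V} (hv : v ∈ G.verts) :
    faces (nbhd G v) = {s : Finset V | v ∉ s ∧ insert v s ∈ faces G} := by
  ext s
  constructor
  · rintro ⟨h₁, h₂⟩
    refine ⟨fun h => (G.adj_sub (h₁ v h)).ne rfl, ?_, ?_⟩
    · intro x hx
      rcases Finset.mem_insert.1 hx with rfl | hx
      exacts [hv, G.edge_vert (h₁ x hx).symm]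
    · rw [Finset.coe_insert]
      exact Set.Pairwise.insert (fun x hx y hy hxy => (h₂ hx hy hxy).2.2)
        fun x hx _ => ⟨h₁ x hx, (h₁ x hx).symm⟩
  · rintro ⟨h, h₁, h₂⟩
    have hN : ∀ x ∈ s, G.Adj v x := fun x hx =>
      h₂ (Finset.mem_insert_self _ _) (Finset.mem_insert_of_mem hx) fun e => h (e ▸ hx)
    exact ⟨hN, fun x hx y hy hxy => ⟨hN x hx, hN y hy,
      h₂ (Finset.mem_insert_of_mem hx) (Finset.mem_insert_of_mem hy) hxy⟩⟩

end Faces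

/-! ### Deleting contractible vertices -/

section Deletion

variable {V : Type u} {A : Type w} [AddCommGroup A]

theorem chains_le_chainsOn (G : GraphOn V) (n : ℕ) : chains A G n ≤ chainsOn A (faces G) := by
  rw [chains_eq_chainsOn]
  exact chainsOn_mono fun s hs => hs.1

theorem cardPart_mem_chains {G : GraphOn V} {c : Finset V →₀ A} (hc : c ∈ chainsOn A (faces G))
    (n : ℕ) : cardPart A (n + 1) c ∈ chains A G n := by
  rw [chains_eq_chainsOn]
  exact cardPart_mem hc _

theorem cardPart_of_mem_chains {G : GraphOn V} {n : ℕ} {c : Finset V →₀ A}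
    (hc : c ∈ chains A G n) : cardPart A (n + 1) c = c := by
  rw [chains_eq_chainsOn] at hc
  exact cardPart_eq (fun s hs => hs.2) hc

variable [LinearOrder V]

theorem IsContractibleVertex.isAcyclic_nbhd {G : GraphOn V} {v : V}
    (h : IsContractibleVertex G v) :
    IsAcyclic (augBoundary A) (chainsOn A (faces (nbhd G v))) := by
  have hcoe : (nbhd G v).coe = (nbhd G v).spanningCoe.induce (nbhd G v).verts := by
    ext x y; rfl
  have hfaces : faces (nbhd G v) = {s ∈ cliques (nbhd G v).spanningCoe |
      (s : Set V) ⊆ (nbhd G v).verts} := by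
    ext s
    exact and_comm
  rw [hfaces]
  have hN := h.2
  rw [hcoe] at hN
  exact AcyclicCliques.isAcyclic_induce hN.acyclicCliques

theorem isRelativeCopy_deleteVertex {G : GraphOn V} {v : V} (hv : v ∈ G.verts) :
    IsRelativeCopy (augBoundary A) (face A v) (join A v) (-1) (chainsOn A (faces G))
      (chainsOn A (faces (deleteVertex G v))) (chainsOn A (faces (nbhd G v))) := by
  rw [faces_deleteVertex, faces_nbhd hv]
  exact isRelativeCopy_vertex A (isLowerSet_faces G) v

theorem boundary_eq_augBoundary {G : GraphOn V} {n : ℕ} {c : Finset V →₀ A}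
    (hc : c ∈ chains A G (n + 1)) : boundary A c = augBoundary A c := by
  rw [chains_eq_chainsOn] at hc
  exact map_eq_of_single _ _ hc fun s hs a => by rw [boundary_single, if_pos (by rw [hs.2]; omega)]

theorem boundary_eq_zero {G : GraphOn V} {c : Finset V →₀ A} (hc : c ∈ chains A G 0) :
    boundary A c = 0 := by
  rw [chains_eq_chainsOn] at hc
  exact map_eq_of_single _ 0 hc fun s hs a => by
    rw [boundary_single, if_neg (by rw [hs.2]; omega)]; rfl

theorem augBoundary_mem_chains {G : GraphOn V} {n : ℕ} {c : Finset V →₀ A}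
    (hc : c ∈ chains A G (n + 1)) : augBoundary A c ∈ chains A G n := by
  rw [← cardPart_of_mem_chains hc, ← cardPart_augBoundary]
  exact cardPart_mem_chains (augBoundary_mem (chains_le_chainsOn G _ hc) (isLowerSet_faces G)) n

theorem boundaries_le_cycles (G : GraphOn V) (n : ℕ) : boundaries A G n ≤ cycles A G n := by
  rintro _ ⟨c, hc, rfl⟩
  have hdc := augBoundary_mem_chains hc
  rw [boundary_eq_augBoundary hc]
  refine ⟨hdc, ?_⟩
  change boundary A _ = 0
  cases n with
  | zero => exact boundary_eq_zero hdc
  | succ n => rw [boundary_eq_augBoundary hdc, augBoundary_augBoundary]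

/-- This reconciles the two boundaries: a `0`-cycle may have nonzero augmentation, but that is a
multiple of the empty simplex, which every subcomplex contains. -/
theorem augBoundary_mem_of_mem_cycles (G : GraphOn V) (v : V) {n : ℕ} {c : Finset V →₀ A}
    (hc : c ∈ cycles A G n) : augBoundary A c ∈ chainsOn A (faces (deleteVertex G v)) := by
  cases n with
  | zero =>
    have h := hc.1
    rw [chains_eq_chainsOn] at h
    refine map_mem_of_single _ h fun s hs a => ?_
    rw [augBoundary_single]
    refine sum_mem fun x hx => zsmul_mem (single_mem_chainsOn a ?_) _
    have : s.erase x = ∅ := by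
      rw [← Finset.card_eq_zero, Finset.card_erase_of_mem hx, hs.2]
    rw [this]
    simp [faces]
  | succ n =>
    rw [← boundary_eq_augBoundary hc.1, AddMonoidHom.mem_ker.1 hc.2]
    exact zero_mem _

theorem join_mem_chains {G : GraphOn V} {v : V} (hv : v ∈ G.verts) {n : ℕ} {b : Finset V →₀ A}
    (hb : b ∈ chains A (nbhd G v) n) : join A v b ∈ chains A G (n + 1) := by
  rw [← cardPart_of_mem_chains hb, ← cardPart_join]
  exact cardPart_mem_chains
    ((isRelativeCopy_deleteVertex hv).map_T b (chains_le_chainsOn _ _ hb)) _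

theorem IsDeletionImage.sub_mem_boundaries {G : GraphOn V} {v : V} (hv : v ∈ G.verts) {n : ℕ}
    {c z : Finset V →₀ A} (h : IsDeletionImage A G n v c z) : z - c ∈ boundaries A G n := by
  obtain ⟨a, -, b, hb, rfl, rfl⟩ := h
  rw [sub_sub_cancel]
  exact ⟨_, join_mem_chains hv hb, rfl⟩

theorem IsContractibleVertex.exists_isDeletionImage {G : GraphOn V} {v : V}
    (hv : IsContractibleVertex G v) {n : ℕ} {c : Finset V →₀ A} (hc : c ∈ cycles A G n) :
    ∃ z ∈ cycles A (deleteVertex G v) n, IsDeletionImage A G n v c z := by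
  obtain ⟨e, he, h⟩ := (isRelativeCopy_deleteVertex hv.1).exists_sub_mem hv.isAcyclic_nbhd
    (chains_le_chainsOn _ _ hc.1) (augBoundary_mem_of_mem_cycles G v hc)
  set b := cardPart A (n + 1) e with hb_def
  -- The chain `e` need not be homogeneous; its part of degree `n` is the `b` of the definition. The
  -- sign `ε = -1` turns the subtraction of a boundary into the addition of `∂(v * b)`.
  have hb : b ∈ chains A (nbhd G v) n := cardPart_mem_chains he n
  have hz : c + boundary A (join A v b) ∈ chains A (deleteVertex G v) n := by
    have := cardPart_mem_chains h n
    rwa [map_sub, cardPart_of_mem_chains hc.1, cardPart_augBoundary, cardPart_join, Units.val_neg,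
      Units.val_one, neg_one_smul, map_neg, map_neg, map_neg, sub_neg_eq_add, ← hb_def,
      ← boundary_eq_augBoundary (join_mem_chains hv.1 hb)] at this
  have himage : IsDeletionImage A G n v c (c + boundary A (join A v b)) :=
    -- Here `a = c + ∂(v * b) - b`, a chain of `G - v` because `N_G(v)` lies in `G - v`.
    ⟨_, sub_mem hz (chains_mono A (nbhd_le_deleteVertex G v) n hb), b, hb, by abel, by abel⟩
  refine ⟨_, ⟨hz, ?_⟩, himage⟩
  have := add_mem (boundaries_le_cycles G n (himage.sub_mem_boundaries hv.1)) hc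
  rw [sub_add_cancel] at this
  exact this.2

/-- This is injectivity on homology. A chain of `G` bounded by `a` is moved into `G - v` by
subtracting a boundary, which leaves its own boundary unchanged. -/
theorem IsContractibleVertex.mem_boundaries {G : GraphOn V} {v : V}
    (hv : IsContractibleVertex G v) {n : ℕ} {a : Finset V →₀ A}
    (ha : a ∈ chains A (deleteVertex G v) n) (h : a ∈ boundaries A G n) :
    a ∈ boundaries A (deleteVertex G v) n := by
  obtain ⟨c, hc, rfl⟩ := h
  rw [boundary_eq_augBoundary hc] at ha ⊢
  obtain ⟨e, -, h⟩ := (isRelativeCopy_deleteVertex hv.1).exists_sub_mem hv.isAcyclic_nbhd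
    (chains_le_chainsOn _ _ hc) (chains_le_chainsOn _ _ ha)
  refine ⟨_, cardPart_mem_chains h (n + 1), ?_⟩
  rw [boundary_eq_augBoundary (cardPart_mem_chains h (n + 1)), ← cardPart_augBoundary, map_sub,
    augBoundary_augBoundary, sub_zero, cardPart_of_mem_chains ha]

theorem IsDeletionSeqImage.sub_mem_boundaries {n : ℕ} {S : List V} {G : GraphOn V}
    (hS : IsContractibleSeq G S) {c z : Finset V →₀ A} (h : IsDeletionSeqImage A n G S c z) :
    z - c ∈ boundaries A G n := by
  induction S generalizing G c with
  | nil =>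
    rw [show z = c from h, sub_self]
    exact zero_mem _
  | cons v S ih =>
    obtain ⟨d, hd, h⟩ := h
    rw [← sub_add_sub_cancel z d c]
    exact add_mem (boundaries_mono A (deleteVertex_le G v) n (ih hS.2 h))
      (hd.sub_mem_boundaries hS.1.1)

theorem exists_isDeletionSeqImage {n : ℕ} {S : List V} {G : GraphOn V}
    (hS : IsContractibleSeq G S) {c : Finset V →₀ A} (hc : c ∈ cycles A G n) :
    ∃ z ∈ cycles A (deleteSeq G S) n, IsDeletionSeqImage A n G S c z := by
  induction S generalizing G c with
  | nil => exact ⟨c, hc, rfl⟩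
  | cons v S ih =>
    obtain ⟨d, hd, h⟩ := hS.1.exists_isDeletionImage hc
    obtain ⟨z, hz, hdz⟩ := ih hS.2 hd
    exact ⟨z, hz, d, h, hdz⟩

theorem mem_boundaries_deleteSeq {n : ℕ} {S : List V} {G : GraphOn V}
    (hS : IsContractibleSeq G S) {a : Finset V →₀ A} (ha : a ∈ chains A (deleteSeq G S) n)
    (h : a ∈ boundaries A G n) : a ∈ boundaries A (deleteSeq G S) n := by
  induction S generalizing G with
  | nil => exact h
  | cons v S ih =>
    exact ih hS.2 ha (hS.1.mem_boundaries (chains_mono A (deleteSeq_le _ S) n ha) h)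

/-! ### Passage to homology classes -/

theorem homologyClass_eq_iff {G : GraphOn V} {n : ℕ} {c z : cycles A G n} :
    homologyClass A G n c = homologyClass A G n z ↔ (z - c : Finset V →₀ A) ∈ boundaries A G n := by
  refine QuotientAddGroup.eq.trans ?_
  rw [AddSubgroup.mem_addSubgroupOf, AddSubgroup.coe_add, AddSubgroup.coe_neg,
    sub_eq_neg_add]

theorem homologyClass_surjective (G : GraphOn V) (n : ℕ) :
    Function.Surjective (homologyClass A G n) := QuotientAddGroup.mk'_surjective _

theorem inclusionMap_homologyClass {G H : GraphOn V} (h : G ≤ H) (n : ℕ) (c : cycles A G n) :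
    inclusionMap A h n (homologyClass A G n c) =
      homologyClass A H n (AddSubgroup.inclusion (cycles_mono A h n) c) := rfl

theorem inclusionMap_eq_of_image {n : ℕ} {S : List V} {G : GraphOn V}
    (hS : IsContractibleSeq G S) {c : cycles A G n} {z : cycles A (deleteSeq G S) n}
    (h : IsDeletionSeqImage A n G S c z) :
    inclusionMap A (deleteSeq_le G S) n (homologyClass A _ n z) = homologyClass A G n c := by
  rw [inclusionMap_homologyClass, eq_comm, homologyClass_eq_iff]
  exact h.sub_mem_boundaries hS

theorem inclusionMap_deleteSeq_bijective {S : List V} {G : GraphOn V}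
    (hS : IsContractibleSeq G S) (n : ℕ) :
    Function.Bijective (inclusionMap A (deleteSeq_le G S) n) := by
  constructor
  · rw [injective_iff_map_eq_zero]
    intro x hx
    obtain ⟨z, rfl⟩ := homologyClass_surjective _ n x
    rw [inclusionMap_homologyClass, ← map_zero (homologyClass A G n), eq_comm,
      homologyClass_eq_iff] at hx
    rw [← map_zero (homologyClass A _ n), eq_comm, homologyClass_eq_iff]
    exact mem_boundaries_deleteSeq hS (sub_mem z.2.1 (zero_mem _)) hx
  · intro x
    obtain ⟨c, rfl⟩ := homologyClass_surjective _ n x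
    obtain ⟨z, hz, h⟩ := exists_isDeletionSeqImage hS c.2
    exact ⟨homologyClass A _ n ⟨z, hz⟩, inclusionMap_eq_of_image (z := ⟨z, hz⟩) hS h⟩

/-- The inclusion sends the class of any image `z` of `c` back to the class of `c`. Thus the inverse
of the inclusion map has the required values, independently of the choices of `b`; since every cycle
has an image that is a cycle, these values determine the homomorphism. -/
theorem isInducedByDeletion_iff {S : List V} {G : GraphOn V} (hS : IsContractibleSeq G S) (n : ℕ)
    (f : Homology A G n →+ Homology A (deleteSeq G S) n) :
    IsInducedByDeletion A G S n f ↔ f = (AddEquiv.ofBijective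
      (inclusionMap A (deleteSeq_le G S) n)
      (inclusionMap_deleteSeq_bijective hS n)).symm.toAddMonoidHom := by
  have hex : ∀ c : cycles A G n, ∃ z : cycles A (deleteSeq G S) n,
      IsDeletionSeqImage A n G S c z := fun c => by
    obtain ⟨z, hz, h⟩ := exists_isDeletionSeqImage hS c.2
    exact ⟨⟨z, hz⟩, h⟩
  have hinv : ∀ (c : cycles A G n) (z : cycles A (deleteSeq G S) n),
      IsDeletionSeqImage A n G S c z → (AddEquiv.ofBijective
        (inclusionMap A (deleteSeq_le G S) n) (inclusionMap_deleteSeq_bijective hS n)).symm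
          (homologyClass A G n c) = homologyClass A _ n z := fun c z h => by
    rw [AddEquiv.symm_apply_eq]
    exact (inclusionMap_eq_of_image hS h).symm
  constructor
  · rintro ⟨-, hf⟩
    refine AddMonoidHom.ext fun x => ?_
    obtain ⟨c, rfl⟩ := homologyClass_surjective _ n x
    obtain ⟨z, hz⟩ := hex c
    exact (hf c z hz).trans (hinv c z hz).symm
  · rintro rfl
    exact ⟨hex, hinv⟩

end Deletion

end GraphHomology

theorem lemma1 {V : Type u} [LinearOrder V] (A : Type w) [AddCommGroup A]
    (G₀ G₁ : GraphHomology.GraphOn V) (hfin : G₁.verts.Finite) (hle : G₀ ≤ G₁)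
    (S₀ S₁ : List V) (hS₀ : GraphHomology.IsContractibleSeq G₀ S₀)
    (hS₁ : GraphHomology.IsContractibleSeq G₁ S₁) (n : ℕ) :
    ∃ (I₀ : GraphHomology.Homology A G₀ n ≃+
          GraphHomology.Homology A (GraphHomology.deleteSeq G₀ S₀) n)
      (I₁ : GraphHomology.Homology A G₁ n ≃+
          GraphHomology.Homology A (GraphHomology.deleteSeq G₁ S₁) n)
      (ι : GraphHomology.Homology A (GraphHomology.deleteSeq G₀ S₀) n →+
          GraphHomology.Homology A (GraphHomology.deleteSeq G₁ S₁) n),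
      (∀ f, GraphHomology.IsInducedByDeletion A G₀ S₀ n f ↔ f = I₀.toAddMonoidHom) ∧
      (∀ f, GraphHomology.IsInducedByDeletion A G₁ S₁ n f ↔ f = I₁.toAddMonoidHom) ∧
      ι.comp I₀.toAddMonoidHom = I₁.toAddMonoidHom.comp (GraphHomology.inclusionMap A hle n) ∧
      ι = (I₁.toAddMonoidHom.comp (GraphHomology.inclusionMap A hle n)).comp
        I₀.symm.toAddMonoidHom := by
  refine ⟨_, _, _, GraphHomology.isInducedByDeletion_iff hS₀ n,
    GraphHomology.isInducedByDeletion_iff hS₁ n, ?_, rfl⟩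
  ext x
  simp
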